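/- Let $n\ge 5$ and let $\mathcal C$ be a cycle with vertices $v_1,\dots,v_n$ in clockwise order. A maximal outerplanar graph of order $n$ is a drawing consisting of $\mathcal C$ together with a triangulation, by edges between vertices of $\mathcal C$ (chords), of the bounded region determined by $\mathcal C$; that is, an inclusion-maximal set of pairwise non-crossing chords is added to $\mathcal C$. The length of a chord is the length of a shortest path in $\mathcal C$ between its endpoints, and the total chord length $\mathrm{TCL}(G)$ is the sum of the lengths of all chords of $G$. Let $\mathrm{minTCL}(n)$ and $\mathrm{maxTCL}(n)$ be the minimum and the maximum of $\mathrm{TCL}(G)$ over all maximal outerplanar graphs $G$ of order $n$. Let $S_n$ (the shell graph) be $\mathcal C$ together with the chords $v_1v_3, v_1v_4,\dots,v_1v_{n-1}$. Let $G_n$ (the greedy graph) be obtained from $\mathcal C$, starting at $v_1$, by adding $n-3$ chords one after the other: at each step one adds, among the new chords at the current starting vertex that cross no edge drawn so far, the one that spans the shortest path of $\mathcal C$ going clockwise from the starting vertex, and its other endpoint becomes the next starting vertex. Theorem. Let $n\ge5$. 1. For every integer $l$ with $\mathrm{TCL}(G_n)\le l\le \mathrm{TCL}(S_n)$ there is a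 maximal outerplanar graph of order $n$ with total chord length equal to $l$. 2. For every integer $l$ with $\mathrm{minTCL}(n)\le l\le \mathrm{maxTCL}(n)$ there is a maximal outerplanar graph of order $n$ with total chord length equal to $l$. -/

import Mathlib

namespace ChordLength

open SimpleGraph

/-- A drawing with vertices `0, 1, …, n - 1` in clockwise order on the `n`-cycle `cycleGraph n`:
the graph contains the cycle, and its other edges (the chords) are drawn in the region bounded by
the cycle. Two edges cross exactly when their endpoints alternate around the cycle; no two edges
may cross. -/
def IsOuterplanarDrawing {n : ℕ} (G : SimpleGraph (Fin n)) : Prop :=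
  cycleGraph n ≤ G ∧
    ∀ a b c d : Fin n, a < b → b < c → c < d → ¬ (G.Adj a c ∧ G.Adj b d)

/-- A maximal outerplanar graph of order `n`, drawn with its bounding cycle: no further edge can
be added without a crossing (so the chords triangulate the bounded region). -/
def IsMaximalOuterplanar {n : ℕ} (G : SimpleGraph (Fin n)) : Prop :=
  Maximal IsOuterplanarDrawing G

/-- The length of a chord: the length of a shortest path in the cycle between its endpoints. -/
noncomputable def chordLength {n : ℕ} (e : Sym2 (Fin n)) : ℕ :=
  Sym2.lift ⟨fun a b => (cycleGraph n).dist a b, fun _ _ => SimpleGraph.dist_comm⟩ e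

open Classical in
/-- The total chord length: the sum of the lengths of all edges that are not in the cycle. -/
noncomputable def totalChordLength {n : ℕ} (G : SimpleGraph (Fin n)) : ℕ :=
  ∑ e ∈ G.edgeFinset \ (cycleGraph n).edgeFinset, chordLength e

/-- The values of the total chord length over all maximal outerplanar graphs of order `n`. -/
def tclValues (n : ℕ) : Set ℕ :=
  {t | ∃ G : SimpleGraph (Fin n), IsMaximalOuterplanar G ∧ totalChordLength G = t}

/-- The minimal total chord length among all maximal outerplanar graphs of order `n`. -/
noncomputable def minTCL (n : ℕ) : ℕ := sInf (tclValues n)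

/-- The maximal total chord length among all maximal outerplanar graphs of order `n`. -/
noncomputable def maxTCL (n : ℕ) : ℕ := sSup (tclValues n)

/-- The shell graph: the cycle together with all the chords at its first vertex. -/
def shellGraph (n : ℕ) : SimpleGraph (Fin n) :=
  cycleGraph n ⊔
    SimpleGraph.fromRel (fun i j => (i : ℕ) = 0 ∧ 2 ≤ (j : ℕ) ∧ (j : ℕ) + 2 ≤ n)

/-- The edge `vw` is not in `G` and can be drawn in the bounded region without a crossing. -/
def CanAddChord {n : ℕ} (G : SimpleGraph (Fin n)) (v w : Fin n) : Prop :=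
  v ≠ w ∧ ¬ G.Adj v w ∧ IsOuterplanarDrawing (G ⊔ SimpleGraph.edge v w)

/-- One step of the greedy algorithm. The state is the current starting endpoint and the graph
built so far. Among the new chords that can be added at the starting endpoint `s.1`, take the one
whose final endpoint is reached first when going clockwise from `s.1`; its final endpoint is the
next starting endpoint. -/
noncomputable def greedyStep {n : ℕ} [NeZero n] (s : Fin n × SimpleGraph (Fin n)) :
    Fin n × SimpleGraph (Fin n) :=
  let d : ℕ := sInf {d : ℕ | CanAddChord s.2 s.1 (s.1 + Fin.ofNat n d)}
  (s.1 + Fin.ofNat n d, s.2 ⊔ SimpleGraph.edge s.1 (s.1 + Fin.ofNat n d))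

/-- The greedy graph: starting with the bare cycle at its first vertex, add `n - 3` chords. -/
noncomputable def greedyGraph (n : ℕ) [NeZero n] : SimpleGraph (Fin n) :=
  (greedyStep^[n - 3] (0, cycleGraph n)).2

theorem cycleGraph_isOuterplanarDrawing (n : ℕ) : IsOuterplanarDrawing (cycleGraph n) := by
  refine ⟨le_rfl, fun a b c d hab hbc hcd => ?_⟩
  rintro ⟨h, -⟩
  rw [SimpleGraph.cycleGraph_adj'] at h
  rw [Fin.lt_def] at hab hbc hcd
  have hd := d.isLt
  rcases h with h | h
  · rw [Fin.sub_def] at h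
    simp only at h
    rw [Nat.mod_eq_of_lt (by omega)] at h
    omega
  · rw [Fin.sub_def] at h
    simp only at h
    rw [show n - (a : ℕ) + c = (c - a : ℕ) + n by omega, Nat.add_mod_right,
      Nat.mod_eq_of_lt (by omega)] at h
    omega

theorem tclValues_nonempty (n : ℕ) : (tclValues n).Nonempty := by
  obtain ⟨G, hG⟩ := (Set.toFinite {G : SimpleGraph (Fin n) | IsOuterplanarDrawing G}).exists_maximal
    ⟨_, cycleGraph_isOuterplanarDrawing n⟩
  exact ⟨_, G, hG, rfl⟩

theorem tclValues_finite (n : ℕ) : (tclValues n).Finite :=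
  (Set.finite_range (fun G : SimpleGraph (Fin n) => totalChordLength G)).subset
    (by rintro t ⟨G, -, rfl⟩; exact ⟨G, rfl⟩)

/-- `minTCL n` is a true minimum. -/
theorem isLeast_minTCL (n : ℕ) : IsLeast (tclValues n) (minTCL n) :=
  ⟨Nat.sInf_mem (tclValues_nonempty n), fun _ h => Nat.sInf_le h⟩

/-- `maxTCL n` is a true maximum. -/
theorem isGreatest_maxTCL (n : ℕ) : IsGreatest (tclValues n) (maxTCL n) :=
  ⟨Nat.sSup_mem (tclValues_nonempty n) (tclValues_finite n).bddAbove,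
    fun _ h => le_csSup (tclValues_finite n).bddAbove h⟩

end ChordLength

/-! ### Costs of binary trees -/

namespace ChordLength

/-! Both claims are instances of one statement: the total chord lengths of all maximal outerplanar
graphs of order `n` have no gaps. For the first claim it remains only to know that the greedy and
shell graphs are maximal outerplanar.

Cut the cycle at the edge between the first and last vertices and take that edge as root. A
triangulation becomes a binary tree with `n - 1` leaves: each edge is a tree vertex, and the
triangle below it splits it into two children. An edge spanning `d` cycle edges sits above `d`
leaves and has length `arcLength n d`. The cycle edges contribute the same amount for every graph,
so tree costs may be studied instead (`totalChordLength_add`, `IsMaximalOuterplanar.treeCost`,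
`TreeCost.exists_isTriangulation`).

The heart is `TreeCost.fillsUp`: from the cost of any tree, every integer up to the cost of the
caterpillar is attained. Hence the caterpillar is the most expensive tree and the costs form an
interval. The proof raises both subtrees to caterpillars, then moves a leaf from the smaller to the
larger one, in such a way that no value is skipped. -/

/-- `TreeCost f m x`: some binary tree with `m` leaves has total cost `x`, where every vertex
(leaf or not) above exactly `d` leaves costs `f d`. -/
inductive TreeCost (f : ℕ → ℕ) : ℕ → ℕ → Prop
  | leaf : TreeCost f 1 (f 1)
  | node {i j x y : ℕ} : TreeCost f i x → TreeCost f j y →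
      TreeCost f (i + j) (f (i + j) + x + y)

theorem TreeCost.pos {f : ℕ → ℕ} {m x : ℕ} (h : TreeCost f m x) : 1 ≤ m := by
  induction h with
  | leaf => exact le_rfl
  | node _ _ h _ => omega

/-- The cost of the caterpillar with `m` leaves. -/
def caterpillarCost (f : ℕ → ℕ) : ℕ → ℕ
  | 0 => 0
  | 1 => f 1
  | m + 2 => f (m + 2) + f 1 + caterpillarCost f (m + 1)

theorem caterpillarCost_succ (f : ℕ → ℕ) {m : ℕ} (hm : 1 ≤ m) :
    caterpillarCost f (m + 1) = f (m + 1) + f 1 + caterpillarCost f m := by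
  obtain ⟨k, rfl⟩ := Nat.exists_eq_add_of_le' hm
  rfl

theorem treeCost_caterpillarCost (f : ℕ → ℕ) {m : ℕ} (hm : 1 ≤ m) :
    TreeCost f m (caterpillarCost f m) := by
  induction m, hm using Nat.le_induction with
  | base => exact TreeCost.leaf
  | succ k hk ih =>
    have h := TreeCost.node TreeCost.leaf ih
    rw [caterpillarCost_succ f hk]
    rwa [add_comm 1 k] at h

/-- The length of a chord cutting off a path with `d` edges from the `n`-cycle. -/
def arcLength (n d : ℕ) : ℕ := min d (n - d)

/-- All the numbers from `x` up to the cost of the caterpillar with `m` leaves are costs. -/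
def FillsUp (f : ℕ → ℕ) (m x : ℕ) : Prop :=
  x ≤ caterpillarCost f m ∧ ∀ l, x ≤ l → l ≤ caterpillarCost f m → TreeCost f m l

/-- Induction on the size of the smaller subtree of the root. If it is a leaf, filling up the other
subtree already ends at the caterpillar. Otherwise both subtrees are filled up separately, and the
remaining values come from the split with one leaf moved to the larger side. -/
theorem fillsUp_node {n m : ℕ} (hn : 4 ≤ n) (hm : m < n)
    (ih : ∀ k < m, ∀ x, TreeCost (arcLength n) k x → FillsUp (arcLength n) k x)
    (i : ℕ) (hi : 1 ≤ i) : ∀ j, i ≤ j → i + j = m → ∀ x y, TreeCost (arcLength n) i x →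
      TreeCost (arcLength n) j y → FillsUp (arcLength n) m (arcLength n m + x + y) := by
  have f1 : arcLength n 1 = 1 := by unfold arcLength; omega
  induction i, hi using Nat.le_induction with
  | base =>
    rintro j - rfl x y hx hy
    obtain ⟨hy1, hy2⟩ := ih j (by omega) y hy
    have hx1 : x = 1 := by
      have h1 : caterpillarCost (arcLength n) 1 = 1 := f1
      generalize hk : 1 = k at hx
      cases hx with
      | leaf => exact f1
      | node h h' => have := h.pos; have := h'.pos; omega
    have hK := caterpillarCost_succ (arcLength n) hy.pos
    rw [add_comm j 1] at hK
    refine ⟨by omega, fun l hl1 hl2 => ?_⟩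
    have := TreeCost.node (TreeCost.leaf) (hy2 (l - arcLength n (1 + j) - 1) (by omega) (by omega))
    convert this using 1
    omega
  | succ i hi ihi =>
    rintro j hij rfl x y hx hy
    obtain ⟨hx1, hx2⟩ := ih (i + 1) (by omega) x hx
    obtain ⟨hy1, hy2⟩ := ih j (by omega) y hy
    have Ki := caterpillarCost_succ (arcLength n) hi
    have Kj := caterpillarCost_succ (arcLength n) hy.pos
    have Kj' := caterpillarCost_succ (arcLength n) (m := j - 1) (by omega)
    rw [show j - 1 + 1 = j by omega] at Kj'
    have K2 : caterpillarCost (arcLength n) 2 = arcLength n 2 + 1 + 1 := by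
      rw [caterpillarCost_succ _ le_rfl, f1]; simp [caterpillarCost, f1]
    have ti := treeCost_caterpillarCost (arcLength n) hi
    have tj := treeCost_caterpillarCost (arcLength n) (m := j + 1) (by omega)
    -- The larger side, now with `j + 1` leaves, starts not as a caterpillar but as a two-leaf tree
    -- joined to a caterpillar. This is cheap enough to start at most one above the last value
    -- reached before the move.
    have tj' := (treeCost_caterpillarCost (arcLength n) (m := 2) (by omega)).node
      (treeCost_caterpillarCost (arcLength n) (m := j - 1) (by omega))
    rw [show 2 + (j - 1) = j + 1 by omega] at tj'
    have h1 := (ihi (j + 1) (by omega) (by omega) _ _ ti tj).1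
    have h2 := (ihi (j + 1) (by omega) (by omega) _ _ ti tj').2
    -- `e1` keeps the present cost below that of the caterpillar; `e2` says that the two ranges
    -- overlap or abut. Both use `i + 1 ≤ j` and `i + 1 + j < n`, which force `arcLength n (i + 1) =
    -- i + 1`.
    have e1 : arcLength n (i + 1) ≤ arcLength n (j + 1) := by unfold arcLength; omega
    have e2 : arcLength n (j + 1) + arcLength n 2 ≤ arcLength n j + arcLength n (i + 1) + 1 := by
      unfold arcLength; omega
    refine ⟨by omega, fun l hl1 hl2 => ?_⟩
    by_cases hl : l ≤ arcLength n (i + 1 + j) + caterpillarCost (arcLength n) (i + 1)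
        + caterpillarCost (arcLength n) j
    · obtain ⟨a, b, ha1, ha2, hb1, hb2, rfl⟩ : ∃ a b, x ≤ a ∧
          a ≤ caterpillarCost (arcLength n) (i + 1) ∧ y ≤ b ∧
          b ≤ caterpillarCost (arcLength n) j ∧ l = arcLength n (i + 1 + j) + a + b := by
        by_cases hc : l ≤ arcLength n (i + 1 + j) + caterpillarCost (arcLength n) (i + 1) + y
        · exact ⟨l - arcLength n (i + 1 + j) - y, y, by omega, by omega, by omega, by omega,
            by omega⟩
        · exact ⟨caterpillarCost (arcLength n) (i + 1),
            l - arcLength n (i + 1 + j) - caterpillarCost (arcLength n) (i + 1),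
            by omega, by omega, by omega, by omega, by omega⟩
      exact (hx2 a ha1 ha2).node (hy2 b hb1 hb2)
    · exact h2 l (by omega) hl2

theorem TreeCost.fillsUp {n : ℕ} (hn : 4 ≤ n) (m : ℕ) (hm : m < n) (x : ℕ)
    (hx : TreeCost (arcLength n) m x) : FillsUp (arcLength n) m x := by
  induction m using Nat.strong_induction_on generalizing x with
  | _ m ih =>
    have key := fillsUp_node hn hm (fun k hk x hx => ih k hk (hk.trans hm) x hx)
    cases hx with
    | leaf => exact ⟨le_rfl, fun l h1 h2 => (le_antisymm h1 h2) ▸ TreeCost.leaf⟩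
    | @node i j x y h h' =>
      rcases le_total i j with hij | hij
      · exact key i h.pos j hij rfl x y h h'
      · rw [add_right_comm]
        exact key j h'.pos i hij (add_comm _ _) y x h' h

/-- Every number between two costs of trees with the same number of leaves is again a cost. -/
theorem TreeCost.of_between {n m x y l : ℕ} (hn : 4 ≤ n) (hm : m < n)
    (hx : TreeCost (arcLength n) m x) (hy : TreeCost (arcLength n) m y) (hxl : x ≤ l)
    (hly : l ≤ y) : TreeCost (arcLength n) m l :=
  (hx.fillsUp hn m hm).2 l hxl (hly.trans (hy.fillsUp hn m hm).1)

end ChordLength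

namespace ChordLength
open SimpleGraph

/-! ### Chord lengths as arc lengths -/

theorem cycleGraph_adj_iff_val {n : ℕ} (hn : 3 ≤ n) (u v : Fin n) :
    (cycleGraph n).Adj u v ↔ (u : ℕ) + 1 = v ∨ (v : ℕ) + 1 = u ∨
      ((u : ℕ) = 0 ∧ (v : ℕ) + 1 = n) ∨ ((v : ℕ) = 0 ∧ (u : ℕ) + 1 = n) := by
  have hu := u.isLt
  have hv := v.isLt
  have key : ∀ a b : Fin n, ((a - b : Fin n) : ℕ) = 1 ↔
      (b : ℕ) + 1 = a ∨ ((a : ℕ) = 0 ∧ (b : ℕ) + 1 = n) := by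
    intro a b
    have ha := a.isLt
    have hb := b.isLt
    rw [Fin.sub_def]
    simp only
    rcases le_or_gt (b : ℕ) a with h | h
    · rw [show n - (b : ℕ) + a = (a - b : ℕ) + n by omega, Nat.add_mod_right,
        Nat.mod_eq_of_lt (by omega)]
      omega
    · rw [Nat.mod_eq_of_lt (by omega)]
      omega
  rw [cycleGraph_adj', key, key]
  omega

theorem cycleGraph_dist_le_sub {n : ℕ} (hn : 3 ≤ n) (k : ℕ) (u v : Fin n)
    (h : (u : ℕ) + k = v) : (cycleGraph n).dist u v ≤ k := by
  have : Nonempty (Fin n) := ⟨u⟩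
  have hconn : (cycleGraph n).Connected := ⟨cycleGraph_preconnected⟩
  induction k generalizing v with
  | zero =>
    obtain rfl : u = v := Fin.ext (by simpa using h)
    simp
  | succ k ih =>
    have hv := v.isLt
    have h1 := ih ⟨u + k, by omega⟩ rfl
    have h2 : (cycleGraph n).dist ⟨u + k, by omega⟩ v = 1 :=
      dist_eq_one_iff_adj.2 ((cycleGraph_adj_iff_val hn _ _).2 (by simp only; omega))
    have h3 := hconn.dist_triangle (u := u) (v := ⟨u + k, by omega⟩) (w := v)
    omega

/-- With truncated subtraction the argument of `arcLength` is the absolute difference of the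
endpoints. One cycle edge, including the one that wraps around, changes this arc length by at most
one. -/
theorem arcLength_le_walk_length {n : ℕ} (hn : 3 ≤ n) {u v : Fin n}
    (p : (cycleGraph n).Walk u v) :
    arcLength n ((u : ℕ) - v + (v - u)) ≤ p.length := by
  induction p with
  | nil => simp [arcLength]
  | @cons u w v h p ih =>
    rw [cycleGraph_adj_iff_val hn] at h
    rw [Walk.length_cons]
    have := u.isLt
    have := v.isLt
    have := w.isLt
    unfold arcLength at *
    omega

theorem cycleGraph_dist {n : ℕ} (hn : 3 ≤ n) {u v : Fin n} (h : u ≤ v) :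
    (cycleGraph n).dist u v = arcLength n (v - u) := by
  have : Nonempty (Fin n) := ⟨u⟩
  have hconn : (cycleGraph n).Connected := ⟨cycleGraph_preconnected⟩
  have huv : (u : ℕ) ≤ v := h
  have hv := v.isLt
  apply le_antisymm
  -- The other bound comes from walking down to `0`, across the edge to `n - 1`, and down to `v`.
  · refine le_min (cycleGraph_dist_le_sub hn _ _ _ (by omega)) ?_
    have h1 := cycleGraph_dist_le_sub hn u ⟨0, by omega⟩ u (by simp)
    have h2 := cycleGraph_dist_le_sub hn (n - 1 - v) v ⟨n - 1, by omega⟩ (by simp only; omega)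
    have h3 : (cycleGraph n).dist ⟨0, by omega⟩ ⟨n - 1, by omega⟩ = 1 :=
      dist_eq_one_iff_adj.2 ((cycleGraph_adj_iff_val hn _ _).2
        (Or.inr (Or.inr (Or.inl ⟨rfl, Nat.sub_add_cancel (by omega)⟩))))
    have h4 := hconn.dist_triangle (u := u) (v := ⟨0, by omega⟩) (w := v)
    have h5 := hconn.dist_triangle (u := ⟨0, by omega⟩) (v := ⟨n - 1, by omega⟩) (w := v)
    rw [SimpleGraph.dist_comm] at h1 h2
    omega
  · obtain ⟨p, hp⟩ := hconn.exists_walk_length_eq_dist u v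
    have := arcLength_le_walk_length hn p
    rwa [hp, show (u : ℕ) - v + (v - u) = v - u by omega] at this

open Classical in
/-- The edges of `G`, as pairs of natural numbers in increasing order. -/
noncomputable def edgePairs {n : ℕ} (G : SimpleGraph (Fin n)) : Finset (ℕ × ℕ) :=
  (Finset.univ.filter fun p : Fin n × Fin n => p.1 < p.2 ∧ G.Adj p.1 p.2).map
    (Fin.valEmbedding.prodMap Fin.valEmbedding)

theorem mk_mem_edgePairs {n : ℕ} {G : SimpleGraph (Fin n)} {x y : ℕ} :
    (x, y) ∈ edgePairs G ↔ x < y ∧ ∃ (hx : x < n) (hy : y < n), G.Adj ⟨x, hx⟩ ⟨y, hy⟩ := by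
  simp only [edgePairs, Finset.mem_map, Finset.mem_filter, Finset.mem_univ, true_and, Prod.exists]
  constructor
  · rintro ⟨a, b, ⟨hab, hG⟩, h⟩
    obtain ⟨rfl, rfl⟩ := Prod.mk.inj h
    exact ⟨hab, a.2, b.2, hG⟩
  · rintro ⟨hxy, hx, hy, h⟩
    exact ⟨⟨x, hx⟩, ⟨y, hy⟩, ⟨hxy, h⟩, rfl⟩

/-- The sum of `f` over the lengths of the pairs in `E`. -/
def pairSum (f : ℕ → ℕ) (E : Finset (ℕ × ℕ)) : ℕ := ∑ p ∈ E, f (p.2 - p.1)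

open Classical in
theorem sum_edgeFinset_chordLength {n : ℕ} (hn : 3 ≤ n) (G : SimpleGraph (Fin n)) :
    ∑ e ∈ G.edgeFinset, chordLength e = pairSum (arcLength n) (edgePairs G) := by
  rw [pairSum, edgePairs, Finset.sum_map]
  symm
  apply Finset.sum_bij (fun p _ => s(p.1, p.2))
  · rintro ⟨a, b⟩ h
    simpa using (Finset.mem_filter.1 h).2.2
  · rintro ⟨a, b⟩ h ⟨c, d⟩ h' he
    have h1 := (Finset.mem_filter.1 h).2.1
    have h2 := (Finset.mem_filter.1 h').2.1
    rcases Sym2.eq_iff.1 he with ⟨e1, e2⟩ | ⟨e1, e2⟩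
    · exact Prod.ext e1 e2
    · simp only at e1 e2 h1 h2
      subst e1 e2
      exact absurd h1 h2.asymm
  · intro e he
    induction e using Sym2.ind with
    | _ a b =>
      have hab : G.Adj a b := by simpa using he
      rcases lt_or_gt_of_ne hab.ne with h | h
      · exact ⟨(a, b), by simp [h, hab], rfl⟩
      · exact ⟨(b, a), by simp [h, hab.symm], Sym2.eq_swap⟩
  · rintro ⟨a, b⟩ h
    exact (cycleGraph_dist hn (Finset.mem_filter.1 h).2.1.le).symm

theorem totalChordLength_add {n : ℕ} (hn : 3 ≤ n) {G : SimpleGraph (Fin n)}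
    (hG : cycleGraph n ≤ G) :
    totalChordLength G + pairSum (arcLength n) (edgePairs (cycleGraph n)) =
      pairSum (arcLength n) (edgePairs G) := by
  classical
  rw [← sum_edgeFinset_chordLength hn, ← sum_edgeFinset_chordLength hn, totalChordLength]
  convert Finset.sum_sdiff (f := chordLength) (edgeFinset_mono hG)

/-! ### From trees to triangulations -/

/-- The pairs in `E` are the edges of a triangulated polygon with vertices `a, a + 1, …, b`. -/
structure IsTriangulation (a b : ℕ) (E : Finset (ℕ × ℕ)) : Prop where
  bound : ∀ x y, (x, y) ∈ E → a ≤ x ∧ x < y ∧ y ≤ b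
  not_cross : ∀ x y z w, (x, z) ∈ E → (y, w) ∈ E → ¬ (x < y ∧ y < z ∧ z < w)
  side : ∀ x, a ≤ x → x < b → (x, x + 1) ∈ E
  base : (a, b) ∈ E
  cross : ∀ x y, a ≤ x → x < y → y ≤ b → (x, y) ∉ E →
    ∃ z w, (z, w) ∈ E ∧ (x < z ∧ z < y ∧ y < w ∨ z < x ∧ x < w ∧ w < y)

theorem IsTriangulation.single (a : ℕ) : IsTriangulation a (a + 1) {(a, a + 1)} where
  bound x y h := by simp at h; omega
  not_cross x y z w h h' := by simp at h h'; omega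
  side x h h' := by simp; omega
  base := by simp
  cross x y h1 h2 h3 h4 := by simp at h4; omega

theorem IsTriangulation.glue {a b c : ℕ} {E F : Finset (ℕ × ℕ)} (hE : IsTriangulation a c E)
    (hF : IsTriangulation c b F) : IsTriangulation a b (insert (a, b) (E ∪ F)) := by
  have hac := (hE.bound _ _ hE.base).2.1
  have hcb := (hF.bound _ _ hF.base).2.1
  refine ⟨?_, ?_, ?_, by simp, ?_⟩
  · intro x y h
    simp only [Finset.mem_insert, Finset.mem_union, Prod.mk.injEq] at h
    rcases h with h | h | h
    · omega
    · have := hE.bound _ _ h; omega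
    · have := hF.bound _ _ h; omega
  · intro x y z w h h' hc
    simp only [Finset.mem_insert, Finset.mem_union, Prod.mk.injEq] at h h'
    rcases h with h | h | h <;> rcases h' with h' | h' | h'
    · omega
    · have := hE.bound _ _ h'; omega
    · have := hF.bound _ _ h'; omega
    · have := hE.bound _ _ h; omega
    · exact hE.not_cross _ _ _ _ h h' hc
    · have := hE.bound _ _ h; have := hF.bound _ _ h'; omega
    · have := hF.bound _ _ h; omega
    · have := hF.bound _ _ h; have := hE.bound _ _ h'; omega
    · exact hF.not_cross _ _ _ _ h h' hc
  · intro x hx hx'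
    simp only [Finset.mem_insert, Finset.mem_union]
    rcases lt_or_ge x c with h | h
    · exact Or.inr (Or.inl (hE.side x hx h))
    · exact Or.inr (Or.inr (hF.side x h hx'))
  · intro x y hx hxy hy h
    simp only [Finset.mem_insert, Finset.mem_union, Prod.mk.injEq, not_or] at h ⊢
    obtain ⟨h1, h2, h3⟩ := h
    rcases le_or_gt y c with hyc | hyc
    · obtain ⟨z, w, hzw, h⟩ := hE.cross x y hx hxy hyc h2
      exact ⟨z, w, Or.inr (Or.inl hzw), h⟩
    rcases le_or_gt c x with hxc | hxc
    · obtain ⟨z, w, hzw, h⟩ := hF.cross x y hxc hxy hy h3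
      exact ⟨z, w, Or.inr (Or.inr hzw), h⟩
    -- The pair straddles `c`. It is crossed by `(a, c)` unless it starts at `a`; then it ends
    -- before `b` and is crossed by `(c, b)`.
    by_cases hax : a < x
    · exact ⟨a, c, Or.inr (Or.inl hE.base), by omega⟩
    · exact ⟨c, b, Or.inr (Or.inr hF.base), by omega⟩

theorem IsTriangulation.pairSum_glue {a b c : ℕ} {E F : Finset (ℕ × ℕ)}
    (hE : IsTriangulation a c E) (hF : IsTriangulation c b F) (f : ℕ → ℕ) :
    pairSum f (insert (a, b) (E ∪ F)) = f (b - a) + pairSum f E + pairSum f F := by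
  have hac := (hE.bound _ _ hE.base).2.1
  have hcb := (hF.bound _ _ hF.base).2.1
  have hd : Disjoint E F := by
    rw [Finset.disjoint_left]
    rintro ⟨x, y⟩ h h'
    have := hE.bound _ _ h
    have := hF.bound _ _ h'
    omega
  have hn : (a, b) ∉ E ∪ F := by
    rw [Finset.mem_union]
    rintro (h | h)
    · have := hE.bound _ _ h; omega
    · have := hF.bound _ _ h; omega
  rw [pairSum, Finset.sum_insert hn, Finset.sum_union hd, add_assoc]
  rfl

/-- A leaf is a single side; a node glues the two smaller polygons to a triangle whose longest side
is the new base. -/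
theorem TreeCost.exists_isTriangulation {f : ℕ → ℕ} {m x : ℕ} (h : TreeCost f m x) :
    ∀ a, ∃ E, IsTriangulation a (a + m) E ∧ pairSum f E = x := by
  induction h with
  | leaf => exact fun a => ⟨_, IsTriangulation.single a, by simp [pairSum]⟩
  | @node i j x y _ _ hi hj =>
    intro a
    obtain ⟨E, hE, rfl⟩ := hi a
    obtain ⟨F, hF, rfl⟩ := hj (a + i)
    rw [add_assoc] at hF
    exact ⟨_, hE.glue hF, by rw [hE.pairSum_glue hF, Nat.add_sub_cancel_left]⟩

/-- The graph on `Fin n` whose edges are the pairs in `E`. -/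
def graphOfPairs (n : ℕ) (E : Finset (ℕ × ℕ)) : SimpleGraph (Fin n) :=
  SimpleGraph.fromRel fun u v => ((u : ℕ), (v : ℕ)) ∈ E

theorem IsTriangulation.graphOfPairs_adj {n b : ℕ} {E : Finset (ℕ × ℕ)}
    (hE : IsTriangulation 0 b E) {u v : Fin n} (huv : u < v) :
    (graphOfPairs n E).Adj u v ↔ ((u : ℕ), (v : ℕ)) ∈ E := by
  rw [graphOfPairs, fromRel_adj]
  have huv' : (u : ℕ) < v := huv
  constructor
  · rintro ⟨-, h | h⟩
    · exact h
    · have := hE.bound _ _ h; omega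
  · exact fun h => ⟨huv.ne, Or.inl h⟩

theorem IsTriangulation.edgePairs_graphOfPairs {n : ℕ} (hn : 1 ≤ n) {E : Finset (ℕ × ℕ)}
    (hE : IsTriangulation 0 (n - 1) E) : edgePairs (graphOfPairs n E) = E := by
  ext ⟨x, y⟩
  rw [mk_mem_edgePairs]
  constructor
  · rintro ⟨hxy, hx, hy, h⟩
    exact (hE.graphOfPairs_adj (by exact hxy)).1 h
  · intro h
    have := hE.bound _ _ h
    exact ⟨by omega, by omega, by omega,
      (hE.graphOfPairs_adj (by rw [Fin.lt_def]; simp only; omega)).2 h⟩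

theorem IsTriangulation.isMaximalOuterplanar {n : ℕ} (hn : 3 ≤ n) {E : Finset (ℕ × ℕ)}
    (hE : IsTriangulation 0 (n - 1) E) : IsMaximalOuterplanar (graphOfPairs n E) := by
  refine ⟨⟨?_, ?_⟩, ?_⟩
  · suffices H : ∀ u v : Fin n, u < v → (cycleGraph n).Adj u v → (graphOfPairs n E).Adj u v by
      intro u v h
      rcases lt_or_gt_of_ne h.ne with hl | hl
      · exact H u v hl h
      · exact (H v u hl h.symm).symm
    intro u v huv h
    rw [hE.graphOfPairs_adj huv]
    rw [cycleGraph_adj_iff_val hn] at h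
    have huv' : (u : ℕ) < v := huv
    have hv := v.isLt
    have : (u : ℕ) + 1 = v ∨ (u : ℕ) = 0 ∧ (v : ℕ) = n - 1 := by omega
    rcases this with h | ⟨h1, h2⟩
    · rw [← h]
      exact hE.side _ (by omega) (by omega)
    · rw [h1, h2]
      exact hE.base
  · rintro a b c d hab hbc hcd ⟨h1, h2⟩
    rw [hE.graphOfPairs_adj (hab.trans hbc)] at h1
    rw [hE.graphOfPairs_adj (hbc.trans hcd)] at h2
    exact hE.not_cross _ _ _ _ h1 h2 ⟨hab, hbc, hcd⟩
  · intro G hG hle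
    suffices H : ∀ u v : Fin n, u < v → G.Adj u v → (graphOfPairs n E).Adj u v by
      intro u v h
      rcases lt_or_gt_of_ne h.ne with hl | hl
      · exact H u v hl h
      · exact (H v u hl h.symm).symm
    intro u v huv h
    rw [hE.graphOfPairs_adj huv]
    by_contra hc
    have hv := v.isLt
    obtain ⟨z, w, hzw, hx⟩ := hE.cross u v (by omega) huv (by omega) hc
    have hb := hE.bound _ _ hzw
    have hzw' : G.Adj ⟨z, by omega⟩ ⟨w, by omega⟩ :=
      hle ((hE.graphOfPairs_adj (by rw [Fin.lt_def]; simp only; omega)).2 hzw)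
    rcases hx with ⟨h1, h2, h3⟩ | ⟨h1, h2, h3⟩
    · exact hG.2 u ⟨z, by omega⟩ v ⟨w, by omega⟩ h1 h2 h3 ⟨h, hzw'⟩
    · exact hG.2 ⟨z, by omega⟩ u ⟨w, by omega⟩ v h1 h2 h3 ⟨hzw', h⟩

/-! ### Crossing in cyclic terms, and from triangulations to trees -/

/-- The vertex `x` lies strictly between `u` and `v` on the clockwise way from `u` to `v`. -/
def Between {n : ℕ} (u x v : Fin n) : Prop :=
  ((u : ℕ) < x ∧ (x : ℕ) < v) ∨ ((x : ℕ) < v ∧ (v : ℕ) < u) ∨ ((v : ℕ) < u ∧ (u : ℕ) < x)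

/-- The chords `uv` and `xy` cross. -/
def Cross {n : ℕ} (u v x y : Fin n) : Prop :=
  (Between u x v ∧ Between v y u) ∨ (Between u y v ∧ Between v x u)

theorem IsOuterplanarDrawing.not_cross {n : ℕ} {G : SimpleGraph (Fin n)}
    (hG : IsOuterplanarDrawing G) {u v x y : Fin n} (huv : G.Adj u v) (hxy : G.Adj x y) :
    ¬ Cross u v x y := by
  wlog h1 : u < v generalizing u v
  · have hne := huv.ne
    exact fun h => this huv.symm (lt_of_le_of_ne (not_lt.1 h1) hne.symm)
      (by unfold Cross at *; tauto)
  wlog h2 : x < y generalizing x y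
  · have hne := hxy.ne
    exact fun h => this hxy.symm (lt_of_le_of_ne (not_lt.1 h2) hne.symm)
      (by unfold Cross at *; tauto)
  intro h
  have h3 := hG.2 u x v y
  have h4 := hG.2 x u y v
  simp only [Fin.lt_def] at h1 h2 h3 h4
  have : ((u : ℕ) < x ∧ (x : ℕ) < v ∧ (v : ℕ) < y) ∨
      ((x : ℕ) < u ∧ (u : ℕ) < y ∧ (y : ℕ) < v) := by
    unfold Cross Between at h
    omega
  rcases this with ⟨a, b, c⟩ | ⟨a, b, c⟩
  · exact h3 a b c ⟨huv, hxy⟩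
  · exact h4 a b c ⟨hxy, huv⟩

theorem isOuterplanarDrawing_of_not_cross {n : ℕ} {G : SimpleGraph (Fin n)}
    (hle : cycleGraph n ≤ G)
    (hG : ∀ u v x y : Fin n, G.Adj u v → G.Adj x y → ¬ Cross u v x y) :
    IsOuterplanarDrawing G := by
  refine ⟨hle, fun a b c d hab hbc hcd ⟨h1, h2⟩ => hG a c b d h1 h2 ?_⟩
  rw [Fin.lt_def] at hab hbc hcd
  unfold Cross Between
  omega

theorem IsOuterplanarDrawing.sup_edge {n : ℕ} {G : SimpleGraph (Fin n)}
    (hG : IsOuterplanarDrawing G) {u v : Fin n}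
    (h : ∀ x y, G.Adj x y → ¬ Cross u v x y) : IsOuterplanarDrawing (G ⊔ edge u v) := by
  apply isOuterplanarDrawing_of_not_cross (hG.1.trans le_sup_left)
  intro a b x y hab hxy
  have key : ∀ a b x y : Fin n, Cross a b x y → Cross b a x y ∧ Cross a b y x ∧ Cross x y a b := by
    intro a b x y h
    unfold Cross Between at *
    omega
  rw [sup_adj, edge_adj] at hab hxy
  rcases hab with hab | ⟨hab, -⟩ <;> rcases hxy with hxy | ⟨hxy, -⟩
  · exact hG.not_cross hab hxy
  · intro hc
    have hc' := (key _ _ _ _ hc).2.2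
    rcases hxy with ⟨rfl, rfl⟩ | ⟨rfl, rfl⟩
    · exact h _ _ hab hc'
    · exact h _ _ hab (key _ _ _ _ hc').1
  · intro hc
    rcases hab with ⟨rfl, rfl⟩ | ⟨rfl, rfl⟩
    · exact h _ _ hxy hc
    · exact h _ _ hxy (key _ _ _ _ hc).1
  · intro hc
    unfold Cross Between at hc
    rcases hab with ⟨rfl, rfl⟩ | ⟨rfl, rfl⟩ <;> rcases hxy with ⟨rfl, rfl⟩ | ⟨rfl, rfl⟩ <;> omega

theorem IsMaximalOuterplanar.exists_cross {n : ℕ} {G : SimpleGraph (Fin n)}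
    (hG : IsMaximalOuterplanar G) {u v : Fin n} (huv : u ≠ v) (h : ¬ G.Adj u v) :
    ∃ x y, G.Adj x y ∧ Cross u v x y := by
  by_contra! hc
  have hle := hG.2 (hG.1.sup_edge hc) le_sup_left
  exact h (hle (by rw [sup_adj, edge_adj]; tauto))

theorem isMaximalOuterplanar_of_exists_cross {n : ℕ} {G : SimpleGraph (Fin n)}
    (hG : IsOuterplanarDrawing G)
    (h : ∀ u v, u ≠ v → ¬ G.Adj u v → ∃ x y, G.Adj x y ∧ Cross u v x y) :
    IsMaximalOuterplanar G := by
  refine ⟨hG, fun H hH hle u v huv => ?_⟩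
  by_contra hc
  obtain ⟨x, y, hxy, hx⟩ := h u v huv.ne hc
  exact hH.not_cross huv (hle hxy) hx

/-- Every edge of a maximal outerplanar graph that is not of the form `a (a + 1)` is the longest
side of a triangle. -/
theorem IsMaximalOuterplanar.exists_triangle {n : ℕ} (hn : 3 ≤ n) {G : SimpleGraph (Fin n)}
    (hG : IsMaximalOuterplanar G) {a b : Fin n} (hab : G.Adj a b) (h : (a : ℕ) + 1 < b) :
    ∃ c, a < c ∧ c < b ∧ G.Adj a c ∧ G.Adj c b := by
  classical
  have hb := b.isLt
  let S : Finset (Fin n) := Finset.univ.filter fun c => a < c ∧ c < b ∧ G.Adj a c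
  have hS : S.Nonempty := ⟨⟨a + 1, by omega⟩, by
    simp only [S, Finset.mem_filter, Finset.mem_univ, true_and, Fin.lt_def]
    exact ⟨by omega, by omega, hG.1.1 ((cycleGraph_adj_iff_val hn _ _).2 (by simp))⟩⟩
  -- The apex is the farthest neighbour of `a` before `b`. An edge crossing `cb` but neither `ab`
  -- nor `ac` would have to start at `a` and end beyond `c`, against this choice.
  obtain ⟨c, hcS, hmax⟩ := S.exists_max_image id hS
  obtain ⟨hac, hcb, hadj⟩ := (Finset.mem_filter.1 hcS).2
  refine ⟨c, hac, hcb, hadj, ?_⟩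
  by_contra hc
  obtain ⟨x, y, hxy, hx⟩ := hG.exists_cross hcb.ne hc
  have key : ∀ x y, G.Adj x y → Between c x b → Between b y c → False := by
    intro x y hxy h1 h2
    have n1 := hG.1.not_cross hab hxy
    have n2 := hG.1.not_cross hadj hxy
    have hm : y = a → x ≤ c := by
      rintro rfl
      refine hmax x ?_
      simp only [S, Finset.mem_filter, Finset.mem_univ, true_and]
      refine ⟨?_, ?_, hxy.symm⟩ <;> unfold Between at * <;> rw [Fin.lt_def] at * <;> omega
    rw [Fin.ext_iff, Fin.le_def] at hm
    rw [Fin.lt_def] at hac hcb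
    unfold Cross Between at *
    omega
  rcases hx with ⟨h1, h2⟩ | ⟨h1, h2⟩
  · exact key x y hxy h1 h2
  · exact key y x hxy.symm h1 h2

/-- The edges drawn over the interval from `a` to `b` form the subtree below the edge `ab`; the apex
`c` of its triangle separates the two child subtrees. -/
theorem IsMaximalOuterplanar.treeCost_filter {n : ℕ} (hn : 3 ≤ n) (f : ℕ → ℕ)
    {G : SimpleGraph (Fin n)} (hG : IsMaximalOuterplanar G) (k : ℕ) :
    ∀ a b : Fin n, G.Adj a b → (a : ℕ) + k = b → 1 ≤ k →
      TreeCost f k (pairSum f ((edgePairs G).filter fun p => (a : ℕ) ≤ p.1 ∧ p.2 ≤ (b : ℕ))) := by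
  induction k using Nat.strong_induction_on with
  | _ k ih =>
    intro a b hab hk h1
    rcases h1.eq_or_lt with rfl | h1
    · have : (edgePairs G).filter (fun p => (a : ℕ) ≤ p.1 ∧ p.2 ≤ (b : ℕ)) = {((a : ℕ), (b : ℕ))} := by
        ext ⟨x, y⟩
        simp only [Finset.mem_filter, mk_mem_edgePairs, Finset.mem_singleton, Prod.mk.injEq]
        constructor
        · rintro ⟨⟨h, -⟩, h'⟩
          omega
        · rintro ⟨rfl, rfl⟩
          exact ⟨⟨by omega, a.2, b.2, hab⟩, le_rfl, le_rfl⟩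
      rw [this, pairSum, Finset.sum_singleton]
      simp only
      rw [← hk, Nat.add_sub_cancel_left]
      exact TreeCost.leaf
    · obtain ⟨c, hac, hcb, hac', hcb'⟩ := hG.exists_triangle hn hab (by omega)
      rw [Fin.lt_def] at hac hcb
      have t1 := ih (c - a) (by omega) a c hac' (by omega) (by omega)
      have t2 := ih (b - c) (by omega) c b hcb' (by omega) (by omega)
      have t := t1.node t2
      rw [show (c : ℕ) - a + (b - c) = k by omega] at t
      convert t using 1
      have hset : (edgePairs G).filter (fun p => (a : ℕ) ≤ p.1 ∧ p.2 ≤ (b : ℕ)) =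
          insert ((a : ℕ), (b : ℕ))
            ((edgePairs G).filter (fun p => (a : ℕ) ≤ p.1 ∧ p.2 ≤ (c : ℕ)) ∪
            (edgePairs G).filter (fun p => (c : ℕ) ≤ p.1 ∧ p.2 ≤ (b : ℕ))) := by
        ext ⟨x, y⟩
        simp only [Finset.mem_filter, mk_mem_edgePairs, Finset.mem_insert, Finset.mem_union,
          Prod.mk.injEq]
        constructor
        · rintro ⟨⟨hxy, hx, hy, h⟩, h1, h2⟩
          have n1 := hG.1.not_cross hac' h
          have n2 := hG.1.not_cross hcb' h
          -- An edge straddling `c` inside the interval other than `ab` would cross `ac` or `cb`.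
          have : (x = a ∧ y = b) ∨ y ≤ c ∨ (c : ℕ) ≤ x := by
            unfold Cross Between at *
            simp only at *
            omega
          rcases this with h' | h' | h'
          · exact Or.inl h'
          · exact Or.inr (Or.inl ⟨⟨hxy, hx, hy, h⟩, h1, h'⟩)
          · exact Or.inr (Or.inr ⟨⟨hxy, hx, hy, h⟩, h', h2⟩)
        · rintro (⟨rfl, rfl⟩ | ⟨h, h1, h2⟩ | ⟨h, h1, h2⟩)
          · exact ⟨⟨by omega, a.2, b.2, hab⟩, le_rfl, le_rfl⟩
          · exact ⟨h, h1, by omega⟩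
          · exact ⟨h, by omega, h2⟩
      rw [hset, pairSum, Finset.sum_insert, Finset.sum_union, add_assoc, show (b : ℕ) - a = k by omega]
      · rfl
      · rw [Finset.disjoint_left]
        rintro ⟨x, y⟩ h h'
        simp only [Finset.mem_filter, mk_mem_edgePairs] at h h'
        omega
      · simp only [Finset.mem_filter, Finset.mem_union]
        omega

theorem IsMaximalOuterplanar.treeCost {n : ℕ} (hn : 3 ≤ n) (f : ℕ → ℕ)
    {G : SimpleGraph (Fin n)} (hG : IsMaximalOuterplanar G) :
    TreeCost f (n - 1) (pairSum f (edgePairs G)) := by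
  have h := hG.treeCost_filter hn f (n - 1) ⟨0, by omega⟩ ⟨n - 1, by omega⟩
    (hG.1.1 ((cycleGraph_adj_iff_val hn _ _).2
      (Or.inr (Or.inr (Or.inl ⟨rfl, Nat.sub_add_cancel (by omega)⟩))))) (by simp) (by omega)
  rwa [Finset.filter_true_of_mem] at h
  rintro ⟨x, y⟩ hxy
  obtain ⟨-, -, hy, -⟩ := mk_mem_edgePairs.1 hxy
  simp only
  omega

/-- The total chord lengths of the maximal outerplanar graphs of order `n` form an interval. -/
theorem exists_isMaximalOuterplanar_of_between {n : ℕ} (hn : 4 ≤ n) {G H : SimpleGraph (Fin n)}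
    (hG : IsMaximalOuterplanar G) (hH : IsMaximalOuterplanar H) {l : ℕ}
    (h1 : totalChordLength G ≤ l) (h2 : l ≤ totalChordLength H) :
    ∃ K : SimpleGraph (Fin n), IsMaximalOuterplanar K ∧ totalChordLength K = l := by
  have hn' : 3 ≤ n := by omega
  have eG := totalChordLength_add hn' hG.1.1
  have eH := totalChordLength_add hn' hH.1.1
  have hc := TreeCost.of_between hn (by omega) (hG.treeCost hn' _) (hH.treeCost hn' _)
    (l := l + pairSum (arcLength n) (edgePairs (cycleGraph n))) (by omega) (by omega)
  obtain ⟨E, hE, hEl⟩ := hc.exists_isTriangulation 0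
  rw [zero_add] at hE
  have hK := hE.isMaximalOuterplanar hn'
  have eK := totalChordLength_add hn' hK.1.1
  rw [hE.edgePairs_graphOfPairs (by omega), hEl] at eK
  exact ⟨_, hK, by omega⟩

end ChordLength

namespace ChordLength
open SimpleGraph

/-! ### The greedy and shell graphs are maximal outerplanar -/

theorem val_sub_cases {n : ℕ} (s p : Fin n) :
    ((s : ℕ) ≤ p ∧ ((p - s : Fin n) : ℕ) + s = p) ∨
      ((p : ℕ) < s ∧ ((p - s : Fin n) : ℕ) + s = p + n) := by
  have hs := s.isLt
  have hp := p.isLt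
  rw [Fin.sub_def]
  simp only
  rcases le_or_gt (s : ℕ) p with h | h
  · rw [show n - (s : ℕ) + p = (p - s : ℕ) + n by omega, Nat.add_mod_right,
      Nat.mod_eq_of_lt (by omega)]
    omega
  · rw [Nat.mod_eq_of_lt (by omega)]
    omega

/-- Measuring clockwise distance from `s` turns cyclic betweenness into a linear order, so that the
next vertex of a polygon is a minimum. -/
theorem between_iff_val_sub {n : ℕ} (s p v : Fin n) :
    Between s p v ↔ 0 < ((p - s : Fin n) : ℕ) ∧ ((p - s : Fin n) : ℕ) < ((v - s : Fin n) : ℕ) := by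
  have h1 := val_sub_cases s p
  have h2 := val_sub_cases s v
  have := s.isLt
  have := p.isLt
  have := v.isLt
  unfold Between
  omega

/-- The chords of `G` triangulate the part of the disc outside the polygon with vertex set `P`,
and the sides of this polygon are edges of `G`. -/
structure IsOuterTriangulation {n : ℕ} (P : Finset (Fin n)) (G : SimpleGraph (Fin n)) : Prop where
  outerplanar : IsOuterplanarDrawing G
  side : ∀ u ∈ P, ∀ v ∈ P, u ≠ v → (∀ p ∈ P, ¬ Between u p v) → G.Adj u v
  cross : ∀ u v, u ∉ P → u ≠ v → ¬ G.Adj u v → ∃ x y, G.Adj x y ∧ Cross u v x y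
  not_separated : ∀ x y, G.Adj x y → ∀ p ∈ P, ∀ q ∈ P, ¬ (Between x p y ∧ Between y q x)

theorem isOuterTriangulation_cycleGraph {n : ℕ} (hn : 3 ≤ n) :
    IsOuterTriangulation Finset.univ (cycleGraph n) where
  outerplanar := cycleGraph_isOuterplanarDrawing n
  side u _ v _ huv h := by
    rw [cycleGraph_adj_iff_val hn]
    have hu := u.isLt
    have hv := v.isLt
    have hne : (u : ℕ) ≠ v := fun h => huv (Fin.ext h)
    by_cases hlast : (u : ℕ) + 1 = n
    · have := h ⟨0, by omega⟩ (Finset.mem_univ _)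
      unfold Between at this
      simp only at this
      omega
    · have := h ⟨u + 1, by omega⟩ (Finset.mem_univ _)
      unfold Between at this
      simp only at this
      omega
  cross u v hu := absurd (Finset.mem_univ u) hu
  not_separated x y h p _ q _ := by
    rw [cycleGraph_adj_iff_val hn] at h
    have := p.isLt
    have := q.isLt
    unfold Between
    omega

/-- Two vertices of a triangle are always joined by a side: otherwise `P` would have a vertex on
each side of the pair, hence four vertices. Every other non-adjacent pair is crossed by the
invariant. -/
theorem IsOuterTriangulation.isMaximalOuterplanar {n : ℕ} {P : Finset (Fin n)}
    {G : SimpleGraph (Fin n)} (hG : IsOuterTriangulation P G) (hP : P.card = 3) :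
    IsMaximalOuterplanar G := by
  refine isMaximalOuterplanar_of_exists_cross hG.outerplanar fun u v huv h => ?_
  have comm : ∀ x y, Cross v u x y → Cross u v x y := by
    intro x y hc
    unfold Cross at *
    tauto
  by_cases hu : u ∈ P
  · by_cases hv : v ∈ P
    · exfalso
      have hne : (u : ℕ) ≠ v := fun h => huv (Fin.ext h)
      obtain ⟨p, hp, hp'⟩ : ∃ p ∈ P, Between u p v := by
        by_contra! h'
        exact h (hG.side u hu v hv huv h')
      obtain ⟨q, hq, hq'⟩ : ∃ q ∈ P, Between v q u := by
        by_contra! h'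
        exact h (hG.side v hv u hu huv.symm h').symm
      have hcard : ({u, v, p, q} : Finset (Fin n)).card = 4 := by
        rw [Finset.card_insert_of_notMem, Finset.card_insert_of_notMem,
          Finset.card_insert_of_notMem, Finset.card_singleton] <;>
        simp only [Finset.mem_insert, Finset.mem_singleton, Fin.ext_iff] <;>
        unfold Between at * <;> omega
      have hle := Finset.card_le_card (s := {u, v, p, q}) (t := P) (by
        intro x hx
        simp only [Finset.mem_insert, Finset.mem_singleton] at hx
        rcases hx with rfl | rfl | rfl | rfl <;> assumption)
      omega
    · obtain ⟨x, y, hxy, hc⟩ := hG.cross v u hv huv.symm (fun h' => h h'.symm)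
      exact ⟨x, y, hxy, comm x y hc⟩
  · exact hG.cross u v hu huv h

/-- A vertex `s` of the polygon `P` is followed clockwise by some `t` and then by some `w`. -/
theorem exists_next_two {n : ℕ} {P : Finset (Fin n)} {s : Fin n} (hP : 4 ≤ P.card) :
    ∃ t ∈ P, ∃ w ∈ P, ∃ q ∈ P, Between s t w ∧ Between w q s ∧
      ∀ p ∈ P, Between s p w → p = t := by
  have h1 : (P.erase s).Nonempty := by
    rw [← Finset.card_pos]
    have := P.pred_card_le_card_erase (a := s)
    omega
  obtain ⟨t, ht, htmin⟩ := Finset.exists_min_image _ (fun p => ((p - s : Fin n) : ℕ)) h1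
  have h2 : ((P.erase s).erase t).Nonempty := by
    rw [← Finset.card_pos]
    have := P.pred_card_le_card_erase (a := s)
    have := (P.erase s).pred_card_le_card_erase (a := t)
    omega
  obtain ⟨w, hw, hwmin⟩ := Finset.exists_min_image _ (fun p => ((p - s : Fin n) : ℕ)) h2
  have h3 : (((P.erase s).erase t).erase w).Nonempty := by
    rw [← Finset.card_pos]
    have := P.pred_card_le_card_erase (a := s)
    have := (P.erase s).pred_card_le_card_erase (a := t)
    have := ((P.erase s).erase t).pred_card_le_card_erase (a := w)
    omega
  obtain ⟨q, hq⟩ := h3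
  simp only [Finset.mem_erase, ne_eq] at ht hw hq htmin hwmin
  have tw := htmin w ⟨hw.2.1, hw.2.2⟩
  have wq := hwmin q ⟨hq.2.1, hq.2.2.1, hq.2.2.2⟩
  have hinj : ∀ x y : Fin n, ((x - s : Fin n) : ℕ) = ((y - s : Fin n) : ℕ) → x = y := by
    intro x y h
    have := val_sub_cases s x
    have := val_sub_cases s y
    apply Fin.ext
    omega
  have hself : ((s - s : Fin n) : ℕ) = 0 := by
    have := val_sub_cases s s
    omega
  have tw' : ((t - s : Fin n) : ℕ) ≠ ((w - s : Fin n) : ℕ) := fun h => hw.1 (hinj _ _ h).symm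
  have wq' : ((w - s : Fin n) : ℕ) ≠ ((q - s : Fin n) : ℕ) := fun h => hq.1 (hinj _ _ h).symm
  have st' : ((t - s : Fin n) : ℕ) ≠ 0 := fun h => ht.1 (hinj _ _ (h.trans hself.symm))
  refine ⟨t, ht.2, w, hw.2.2, q, hq.2.2.2, ?_, ?_, ?_⟩
  · rw [between_iff_val_sub]
    omega
  · have := val_sub_cases s w
    have := val_sub_cases s q
    have := q.isLt
    have := w.isLt
    have := s.isLt
    unfold Between
    omega
  · intro p hp hb
    rw [between_iff_val_sub] at hb
    by_contra hne
    have := hwmin p ⟨hne, fun h => by rw [h, hself] at hb; omega, hp⟩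
    omega

/-- Cutting off the ear at `t` preserves the invariant. The chord `sw` is new because it separates
`t` from `q`, and nothing crosses it because a crossing edge would separate `s` from `w`. A missing
edge at `t` either crosses `sw` or ends at a vertex already outside the polygon. -/
theorem IsOuterTriangulation.cut {n : ℕ} {P : Finset (Fin n)} {G : SimpleGraph (Fin n)}
    (hG : IsOuterTriangulation P G) {s t w q : Fin n} (hs : s ∈ P) (ht : t ∈ P) (hw : w ∈ P)
    (hq : q ∈ P) (hst : Between s t w) (hwq : Between w q s)
    (h : ∀ p ∈ P, Between s p w → p = t) :
    CanAddChord G s w ∧ IsOuterTriangulation (P.erase t) (G ⊔ edge s w) := by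
  have hadd : CanAddChord G s w := by
    refine ⟨?_, ?_, ?_⟩
    · rintro rfl
      unfold Between at hst
      omega
    · exact fun hadj => hG.not_separated s w hadj t ht q hq ⟨hst, hwq⟩
    · refine hG.outerplanar.sup_edge fun x y hxy hc => ?_
      have n1 := hG.not_separated x y hxy s hs w hw
      have n2 := hG.not_separated x y hxy w hw s hs
      unfold Cross Between at *
      omega
  have hadj : (G ⊔ edge s w).Adj s w := by
    rw [sup_adj, edge_adj]
    exact Or.inr ⟨Or.inl ⟨rfl, rfl⟩, hadd.1⟩
  have hle : G ≤ G ⊔ edge s w := le_sup_left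
  refine ⟨hadd, hadd.2.2, ?_, ?_, ?_⟩
  · intro u hu v hv huv hb
    simp only [Finset.mem_erase, ne_eq] at hu hv hb
    by_cases hsu : u = s ∧ v = w
    · rw [hsu.1, hsu.2]
      exact hadj
    · refine hle (hG.side u hu.2 v hv.2 huv fun p hp hp' => ?_)
      by_cases hpt : p = t
      · subst hpt
        have n1 := hb s ⟨fun e => by subst e; unfold Between at hst; omega, hs⟩
        have n2 := hb w ⟨fun e => by subst e; unfold Between at hst; omega, hw⟩
        have n3 : ¬ Between s u w := fun e => hu.1 (h u hu.2 e)
        have n4 : ¬ Between s v w := fun e => hv.1 (h v hv.2 e)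
        simp only [Fin.ext_iff] at hsu
        clear hG hadj hle hadd hb h
        unfold Between at *
        omega
      · exact hb p ⟨hpt, hp⟩ hp'
  · intro u v hu huv hadj'
    have hold : u ∉ P → ∃ x y, (G ⊔ edge s w).Adj x y ∧ Cross u v x y := by
      intro huP
      obtain ⟨x, y, hxy, hc⟩ := hG.cross u v huP huv (fun e => hadj' (hle e))
      exact ⟨x, y, hle hxy, hc⟩
    by_cases hut : u = t
    · subst hut
      by_cases hvo : Between w v s
      · refine ⟨s, w, hadj, ?_⟩
        unfold Cross Between at *
        omega
      have hvs : v ≠ s := by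
        rintro rfl
        refine hadj' (hle (hG.side _ hs _ ht huv.symm fun p hp hp' => ?_).symm)
        have := h p hp (by unfold Between at *; omega)
        subst this
        unfold Between at hp'
        omega
      have hvw : v ≠ w := by
        rintro rfl
        refine hadj' (hle (hG.side _ ht _ hw huv fun p hp hp' => ?_))
        have := h p hp (by unfold Between at *; omega)
        subst this
        unfold Between at hp'
        omega
      have hvi : Between s v w := by
        rw [ne_eq, Fin.ext_iff] at hvs hvw
        unfold Between at *
        omega
      obtain ⟨x, y, hxy, hc⟩ := hG.cross v u (fun e => huv (h v e hvi).symm) huv.symm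
        (fun e => hadj' (hle e.symm))
      refine ⟨x, y, hle hxy, ?_⟩
      unfold Cross at *
      tauto
    · exact hold fun e => hu (Finset.mem_erase.2 ⟨hut, e⟩)
  · intro x y hxy p hp q' hq'
    rw [Finset.mem_erase] at hp hq'
    rw [sup_adj, edge_adj] at hxy
    rcases hxy with hxy | ⟨⟨rfl, rfl⟩ | ⟨rfl, rfl⟩, -⟩
    · exact hG.not_separated x y hxy p hp.2 q' hq'.2
    · exact fun e => hp.1 (h p hp.2 e.1)
    · exact fun e => hq'.1 (h q' hq'.2 e.2)

theorem val_add_ofNat_sub {n : ℕ} [NeZero n] (s : Fin n) {d : ℕ} (hd : d < n) :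
    ((s + Fin.ofNat n d - s : Fin n) : ℕ) = d := by
  rw [add_sub_cancel_left]
  exact Nat.mod_eq_of_lt hd

/-- No shorter chord from `s` is available: ending at `t` it would be a side, already drawn; ending
off the polygon it would be an old edge or cross one. -/
theorem IsOuterTriangulation.sInf_canAddChord {n : ℕ} [NeZero n] {P : Finset (Fin n)}
    {G : SimpleGraph (Fin n)} (hG : IsOuterTriangulation P G) {s t w : Fin n} (hs : s ∈ P)
    (ht : t ∈ P) (hst : Between s t w) (h : ∀ p ∈ P, Between s p w → p = t)
    (hadd : CanAddChord G s w) :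
    sInf {d : ℕ | CanAddChord G s (s + Fin.ofNat n d)} = ((w - s : Fin n) : ℕ) := by
  refine IsLeast.csInf_eq ⟨?_, ?_⟩
  · change CanAddChord G s (s + Fin.ofNat n ((w - s : Fin n) : ℕ))
    rwa [Fin.ofNat_val_eq_self, add_sub_cancel]
  · intro d hd
    by_contra! hlt
    have hv := val_add_ofNat_sub s (hlt.trans (w - s).isLt)
    change CanAddChord G s (s + Fin.ofNat n d) at hd
    generalize s + Fin.ofNat n d = v at hd hv
    obtain ⟨hne, hnadj, hout⟩ := hd
    have hb : Between s v w := by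
      rw [between_iff_val_sub, hv]
      refine ⟨Nat.pos_of_ne_zero fun h0 => hne ?_, hlt⟩
      have := val_sub_cases s v
      apply Fin.ext
      omega
    by_cases hvP : v ∈ P
    · obtain rfl := h v hvP hb
      refine hnadj (hG.side s hs v hvP hne fun p hp hp' => ?_)
      have := h p hp (by unfold Between at *; omega)
      subst this
      unfold Between at hp'
      omega
    · obtain ⟨x, y, hxy, hc⟩ := hG.cross v s hvP hne.symm (fun e => hnadj e.symm)
      refine hout.not_cross (u := v) (v := s) ?_ (le_sup_left (a := G) hxy) hc
      rw [sup_adj, edge_adj]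
      exact Or.inr ⟨Or.inr ⟨rfl, rfl⟩, hne.symm⟩

theorem IsOuterTriangulation.greedyStep {n : ℕ} [NeZero n] {P : Finset (Fin n)}
    {S : Fin n × SimpleGraph (Fin n)} (hS : S.1 ∈ P) (hG : IsOuterTriangulation P S.2)
    (hP : 4 ≤ P.card) :
    ∃ Q : Finset (Fin n), Q.card + 1 = P.card ∧ (greedyStep S).1 ∈ Q ∧
      IsOuterTriangulation Q (greedyStep S).2 := by
  obtain ⟨s, G⟩ := S
  obtain ⟨t, ht, w, hw, q, hq, hst, hwq, h⟩ := exists_next_two (s := s) hP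
  obtain ⟨hadd, hcut⟩ := hG.cut hS ht hw hq hst hwq h
  have hstep : ChordLength.greedyStep (s, G) = (w, G ⊔ edge s w) := by
    unfold ChordLength.greedyStep
    simp only
    rw [hG.sInf_canAddChord hS ht hst h hadd, Fin.ofNat_val_eq_self, add_sub_cancel]
  rw [hstep]
  refine ⟨P.erase t, Finset.card_erase_add_one ht, Finset.mem_erase.2 ⟨?_, hw⟩, hcut⟩
  intro e
  obtain rfl : w = t := e
  unfold Between at hst
  omega

/-- Each greedy step cuts one ear, so `n - 3` steps leave a triangle. -/
theorem exists_isOuterTriangulation_greedyStep_iterate {n : ℕ} [NeZero n] (hn : 3 ≤ n) (k : ℕ)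
    (hk : k + 3 ≤ n) :
    ∃ P : Finset (Fin n), P.card + k = n ∧ (greedyStep^[k] (0, cycleGraph n)).1 ∈ P ∧
      IsOuterTriangulation P (greedyStep^[k] (0, cycleGraph n)).2 := by
  induction k with
  | zero =>
    exact ⟨Finset.univ, by simp, Finset.mem_univ _, isOuterTriangulation_cycleGraph hn⟩
  | succ k ih =>
    obtain ⟨P, hcard, hmem, hP⟩ := ih (by omega)
    obtain ⟨Q, hQ, hmem', hQ'⟩ := hP.greedyStep hmem (by omega)
    rw [Function.iterate_succ_apply']
    exact ⟨Q, by omega, hmem', hQ'⟩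

theorem greedyGraph_isMaximalOuterplanar {n : ℕ} [NeZero n] (hn : 3 ≤ n) :
    IsMaximalOuterplanar (greedyGraph n) := by
  obtain ⟨P, hcard, -, hP⟩ :=
    exists_isOuterTriangulation_greedyStep_iterate hn (n - 3) (by omega)
  exact hP.isMaximalOuterplanar (by omega)

theorem shellGraph_adj_iff {n : ℕ} (hn : 3 ≤ n) {u v : Fin n} (huv : u < v) :
    (shellGraph n).Adj u v ↔ (u : ℕ) + 1 = v ∨ (u : ℕ) = 0 := by
  rw [shellGraph, sup_adj, fromRel_adj, cycleGraph_adj_iff_val hn, ne_eq, Fin.ext_iff]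
  rw [Fin.lt_def] at huv
  have := v.isLt
  omega

theorem shellGraph_isMaximalOuterplanar {n : ℕ} (hn : 3 ≤ n) :
    IsMaximalOuterplanar (shellGraph n) := by
  refine ⟨⟨le_sup_left, ?_⟩, ?_⟩
  · rintro a b c d hab hbc hcd ⟨h1, h2⟩
    rw [shellGraph_adj_iff hn (hab.trans hbc)] at h1
    rw [shellGraph_adj_iff hn (hbc.trans hcd)] at h2
    rw [Fin.lt_def] at hab hbc hcd
    omega
  · intro G hG hle
    suffices H : ∀ u v : Fin n, u < v → G.Adj u v → (shellGraph n).Adj u v by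
      intro u v h
      rcases lt_or_gt_of_ne h.ne with hl | hl
      · exact H u v hl h
      · exact (H v u hl h.symm).symm
    intro u v huv h
    rw [shellGraph_adj_iff hn huv]
    by_contra! hc
    have hv := v.isLt
    have huv' : (u : ℕ) < v := huv
    -- An additional edge `uv` has `0 < u` and `u + 1 < v`, so the shell edge from `0` to `u + 1`
    -- crosses it.
    refine hG.2 ⟨0, by omega⟩ u ⟨u + 1, by omega⟩ v ?_ ?_ ?_ ⟨hle ?_, h⟩
    · rw [Fin.lt_def]; simp only; omega
    · rw [Fin.lt_def]; simp only; omega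
    · rw [Fin.lt_def]; simp only; omega
    · exact (shellGraph_adj_iff hn (by rw [Fin.lt_def]; simp only; omega)).2 (Or.inr rfl)

end ChordLength

theorem mainTheorem4 (n : ℕ) [NeZero n] (hn : 5 ≤ n) :
    (∀ l : ℕ, ChordLength.totalChordLength (ChordLength.greedyGraph n) ≤ l →
      l ≤ ChordLength.totalChordLength (ChordLength.shellGraph n) →
      ∃ G : SimpleGraph (Fin n),
        ChordLength.IsMaximalOuterplanar G ∧ ChordLength.totalChordLength G = l) ∧
    (∀ l : ℕ, ChordLength.minTCL n ≤ l → l ≤ ChordLength.maxTCL n →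
      ∃ G : SimpleGraph (Fin n),
        ChordLength.IsMaximalOuterplanar G ∧ ChordLength.totalChordLength G = l) := by
  refine ⟨fun l h1 h2 => ?_, fun l h1 h2 => ?_⟩
  · exact ChordLength.exists_isMaximalOuterplanar_of_between (by omega)
      (ChordLength.greedyGraph_isMaximalOuterplanar (by omega))
      (ChordLength.shellGraph_isMaximalOuterplanar (by omega)) h1 h2
  · obtain ⟨G, hG, hGmin⟩ := (ChordLength.isLeast_minTCL n).1
    obtain ⟨H, hH, hHmax⟩ := (ChordLength.isGreatest_maxTCL n).1
    exact ChordLength.exists_isMaximalOuterplanar_of_between (by omega) hG hH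
      (hGmin.trans_le h1) (h2.trans_eq hHmax.symm)
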